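/- All spaces are Hausdorff. For subsets $S,B$ of a space $Y$ and $k\ge 0$, write $S\hookrightarrow_k B$ if every continuous map from the $k$-sphere $\mathbb S^k$ to $S$ can be extended to a continuous map from the $(k+1)$-ball $\mathbb B^{k+1}$ to $B$. A mapping $\varphi$ from a space $X$ to the nonempty subsets of $Y$ (written $\varphi:X\rightsquigarrow Y$) is called lower locally constant if the set $\{x\in X: K\subset\varphi(x)\}$ is open in $X$ for every compact $K\subset Y$. For an integer $n\ge 0$, $\dim(X)\le n$ means that every finite open cover of $X$ has an open refinement (again a cover of $X$) in which any $n+2$ distinct members have empty intersection. **Theorem 3.1.** Let $n\ge 0$, let $X$ be a paracompact Hausdorff space with $\dim(X)\le n$, let $Y$ be a Hausdorff space, and let $\varphi_0,\dots,\varphi_n: X\rightsquigarrow Y$ be lower locally constant mappings with nonempty values that form an aspherical sequence, i.e. $\varphi_k(x)\hookrightarrow_k\varphi_{k+1}(x)$ for all $x\in X$ and all $0\le k<n$. Then $\varphi_n$ has a continuous selection, i.e. there is a continuous map $f:X\to Y$ with $f(x)\in\varphi_n(x)$ for all $x\in X$. -/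

import Mathlib

/-- The order of a family `𝒱` of subsets of `X` does not exceed `n`: any `n + 2` or more distinct
members of `𝒱` have empty intersection. -/
def CoverOrderLE {X : Type*} (𝒱 : Set (Set X)) (n : ℕ) : Prop :=
  ∀ σ : Finset (Set X), (σ : Set (Set X)) ⊆ 𝒱 → n + 2 ≤ σ.card → ⋂₀ (σ : Set (Set X)) = ∅

/-- The family `𝒰` is an open cover of the space `X`. -/
def IsOpenCoverFamily {X : Type*} [TopologicalSpace X] (𝒰 : Set (Set X)) : Prop :=
  (∀ U ∈ 𝒰, IsOpen U) ∧ ⋃₀ 𝒰 = Set.univ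

/-- The covering dimension of `X` is at most `n`: every *finite* open cover of `X` has an open
refinement (again a cover) of order at most `n`. -/
def CoveringDimLE (X : Type*) [TopologicalSpace X] (n : ℕ) : Prop :=
  ∀ 𝒰 : Set (Set X), 𝒰.Finite → IsOpenCoverFamily 𝒰 →
    ∃ 𝒱 : Set (Set X), IsOpenCoverFamily 𝒱 ∧ (∀ V ∈ 𝒱, ∃ U ∈ 𝒰, V ⊆ U) ∧ CoverOrderLE 𝒱 n

/-- A set-valued mapping is lower locally constant if `{x | K ⊆ φ x}` is open for every compact
subset `K` of the codomain. -/
def LowerLocallyConstant {X Y : Type*} [TopologicalSpace X] [TopologicalSpace Y]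
    (φ : X → Set Y) : Prop :=
  ∀ K : Set Y, IsCompact K → IsOpen {x | K ⊆ φ x}

/-- Every continuous map of the `k`-sphere (the unit sphere of `ℝ^(k+1)`) to `S` extends to a
continuous map of the `(k+1)`-ball (the closed unit ball of `ℝ^(k+1)`) to `B`. -/
def SphereFillable {Y : Type*} [TopologicalSpace Y] (k : ℕ) (S B : Set Y) : Prop :=
  ∀ g : C(Metric.sphere (0 : EuclideanSpace ℝ (Fin (k + 1))) 1, S),
    ∃ h : C(Metric.closedBall (0 : EuclideanSpace ℝ (Fin (k + 1))) 1, B),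
      ∀ x : Metric.sphere (0 : EuclideanSpace ℝ (Fin (k + 1))) 1,
        (h ⟨x, Metric.sphere_subset_closedBall x.2⟩ : Y) = g x

/-- The sequence `φ 0, …, φ n` of set-valued mappings is aspherical. -/
def IsAspherical {X Y : Type*} [TopologicalSpace Y] {n : ℕ}
    (φ : Fin (n + 1) → X → Set Y) : Prop :=
  ∀ (k : Fin n) (x : X), SphereFillable (k : ℕ) (φ k.castSucc x) (φ k.succ x)

/-!
The selection is built over the skeletons of nerves of finer and finer covers. A point `y ∈ φ 0 x`
lies in `φ 0 x'` for all `x'` near `x`, which gives an open cover of `X` and a map of the vertices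
of its nerve into `Y` (`LowerLocallyConstant.exists_isNerveMap_zero`). Suppose that for a locally
finite open cover `U` there is a map of the `k`-skeleton of its nerve sending the simplex spanned by
`σ` into `φ k x` for all `x ∈ ⋂ i ∈ σ, U i` (`IsNerveMap`). Since `φ k x ↪_k φ (k + 1) x`, this map
extends, for each single `x`, over the `(k + 1)`-skeleton of the finite simplex spanned by the
members containing `x`. The image of this skeleton is compact, so it remains in `φ (k + 1) x'` for
`x'` near `x`; a refinement in the manner of a star-refinement then makes the choices for different
`x` fit together into a map of the `(k + 1)`-skeleton of a new nerve (`IsNerveMap.exists_succ`).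
The topology used here is only that spheres and balls may be replaced by boundaries of simplices
and simplices (`SphereFillable.exists_extension_simplexOn`).

For `k = n`, the cover is shrunk to one of order at most `n`; a partition of unity then maps `X`
into the `n`-skeleton of the nerve, and the composition is the selection
(`IsNerveMap.exists_selection`). Since the dimension is defined by finite covers while the cover at
hand is only locally finite, this requires Dowker's theorem (`CoveringDimLE.exists_shrink`).

The nerve is not made into a space: its simplices `simplexOn σ` are subsets of `ι → ℝ`, and a map of
a skeleton is a function on `ι → ℝ` that is continuous on each simplex of that skeleton.
-/

open Set Topology

/-! ### Shrinking locally finite covers to a given order -/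

/-- In a space of covering dimension at most `n`, the members of an open cover which are indexed by
a set `σ` of `n + 2` indices can be shrunk so as to have no common point, keeping the other members
and changing these ones only on the closure of their intersection. -/
theorem CoveringDimLE.exists_shrink_finset {X ι : Type*} [TopologicalSpace X] {n : ℕ}
    (hdim : CoveringDimLE X n) {U : ι → Set X} (hUo : ∀ i, IsOpen (U i)) (hUc : ⋃ i, U i = univ)
    {σ : Finset ι} (hσ : σ.card = n + 2) :
    ∃ W : ι → Set X, (∀ i, IsOpen (W i)) ∧ (∀ i, W i ⊆ U i) ∧ ⋃ i, W i = univ ∧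
      ⋂ i ∈ σ, W i = ∅ ∧ ∀ i, U i \ W i ⊆ closure (⋂ j ∈ σ, U j) := by
  classical
  obtain ⟨i₀, hi₀⟩ : σ.Nonempty := Finset.card_pos.1 (by omega)
  -- The members outside `σ` are merged into the one with index `i₀`, so that `σ` indexes a cover.
  let A : ι → Set X := fun i => if i = i₀ then ⋃ j, ⋃ _ : j ∉ σ ∨ j = i₀, U j else U i
  have hA : IsOpenCoverFamily (A '' σ) := by
    constructor
    · rintro _ ⟨i, -, rfl⟩
      dsimp only [A]
      split_ifs
      · exact isOpen_iUnion fun j => isOpen_iUnion fun _ => hUo j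
      · exact hUo i
    · refine eq_univ_of_forall fun x => ?_
      obtain ⟨j, hj⟩ := mem_iUnion.1 (hUc ▸ mem_univ x)
      by_cases hjσ : j ∉ σ ∨ j = i₀
      · refine ⟨A i₀, ⟨i₀, hi₀, rfl⟩, ?_⟩
        simp only [A, if_pos rfl, mem_iUnion]
        exact ⟨j, hjσ, hj⟩
      · push Not at hjσ
        exact ⟨A j, ⟨j, hjσ.1, rfl⟩, by simpa only [A, if_neg hjσ.2] using hj⟩
  obtain ⟨𝒱, ⟨h𝒱o, h𝒱c⟩, h𝒱r, h𝒱⟩ := hdim _ (σ.finite_toSet.image A) hA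
  have h𝒱r' : ∀ V : 𝒱, ∃ i ∈ σ, (V : Set X) ⊆ A i := fun V => by
    obtain ⟨_, ⟨i, hi, rfl⟩, h⟩ := h𝒱r V V.2
    exact ⟨i, hi, h⟩
  choose p hpσ hp using h𝒱r'
  let B : ι → Set X := fun i => ⋃ V : 𝒱, ⋃ _ : p V = i, (V : Set X)
  have hBo : ∀ i, IsOpen (B i) := fun i =>
    isOpen_iUnion fun V => isOpen_iUnion fun _ => h𝒱o V V.2
  let D : Set X := closure (⋂ j ∈ σ, U j)
  refine ⟨fun i => if i ∈ σ then U i ∩ (B i ∪ Dᶜ) else U i, fun i => ?_, fun i => ?_, ?_, ?_, ?_⟩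
  · dsimp only
    split_ifs
    · exact (hUo i).inter ((hBo i).union isClosed_closure.isOpen_compl)
    · exact hUo i
  · dsimp only
    split_ifs
    · exact inter_subset_left
    · exact Subset.rfl
  · refine eq_univ_of_forall fun x => mem_iUnion.2 ?_
    obtain ⟨V, hV, hxV⟩ := mem_sUnion.1 (h𝒱c ▸ mem_univ x)
    have hxB : x ∈ B (p ⟨V, hV⟩) := mem_iUnion₂.2 ⟨⟨V, hV⟩, rfl, hxV⟩
    have hxA := hp ⟨V, hV⟩ hxV
    by_cases h0 : p ⟨V, hV⟩ = i₀
    · simp only [A, if_pos h0, mem_iUnion] at hxA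
      obtain ⟨j, hj, hxj⟩ := hxA
      by_cases hjσ : j ∈ σ
      · obtain rfl : j = i₀ := hj.resolve_left (not_not.2 hjσ)
        exact ⟨j, by simpa only [if_pos hjσ] using ⟨hxj, Or.inl (h0 ▸ hxB)⟩⟩
      · exact ⟨j, by simpa only [if_neg hjσ] using hxj⟩
    · simp only [A, if_neg h0] at hxA
      exact ⟨p ⟨V, hV⟩, by simpa only [if_pos (hpσ ⟨V, hV⟩)] using ⟨hxA, Or.inl hxB⟩⟩
  · refine eq_empty_of_forall_notMem fun x hx => ?_
    have hx' : ∀ i ∈ σ, x ∈ U i ∩ (B i ∪ Dᶜ) := fun i hi => by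
      simpa only [if_pos hi] using mem_iInter₂.1 hx i hi
    have hxD : x ∈ D := subset_closure (mem_iInter₂.2 fun i hi => (hx' i hi).1)
    have hxV : ∀ i : σ, ∃ V : 𝒱, p V = i ∧ x ∈ (V : Set X) := fun i => by
      have := (hx' i i.2).2.resolve_right (not_not.2 hxD)
      simpa only [B, mem_iUnion, exists_prop] using this
    choose v hpv hxv using hxV
    have hinj : Function.Injective fun i : σ => (v i : Set X) := fun i j hij => by
      have : v i = v j := Subtype.ext hij
      exact Subtype.ext ((hpv i).symm.trans ((congrArg p this).trans (hpv j)))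
    have hmem : x ∈ ⋂₀ ((Finset.univ.image fun i : σ => (v i : Set X) : Finset (Set X)) :
        Set (Set X)) := by
      simpa using fun i hi => hxv ⟨i, hi⟩
    rw [h𝒱 _ (by simp [range_subset_iff])
      (by rw [Finset.card_image_of_injective _ hinj]; simp [hσ])] at hmem
    exact hmem
  · rintro i x ⟨hxU, hxW⟩
    by_contra hxD
    refine hxW ?_
    dsimp only
    split_ifs
    · exact ⟨hxU, Or.inr hxD⟩
    · exact hxU

/-- **Dowker's theorem** for locally finite covers: if *finite* open covers of `X` have open
refinements of order at most `n`, then a *locally finite* open cover can be shrunk, member by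
member, to an open cover of which no `n + 2` members (with different indices) have a common point.

Zorn's lemma is applied to pairs of a shrinking and a set of index sets on which the shrinking is
known to have empty intersection. A later pair may differ from an earlier one only near the
intersections `⋂ i ∈ σ, U i` of the newly treated `σ`; by local finiteness only finitely many of
these matter near a given point, so that intersections along chains are again open covers. -/
theorem CoveringDimLE.exists_shrink {X ι : Type*} [TopologicalSpace X] {n : ℕ}
    (hdim : CoveringDimLE X n) {U : ι → Set X} (hUo : ∀ i, IsOpen (U i)) (hUc : ⋃ i, U i = univ)
    (hUf : LocallyFinite U) :
    ∃ W : ι → Set X, (∀ i, IsOpen (W i)) ∧ (∀ i, W i ⊆ U i) ∧ ⋃ i, W i = univ ∧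
      ∀ σ : Finset ι, σ.card = n + 2 → ⋂ i ∈ σ, W i = ∅ := by
  classical
  let P : Type _ := {p : Set (Finset ι) × (ι → Set X) // (∀ i, IsOpen (p.2 i)) ∧
    (∀ i, p.2 i ⊆ U i) ∧ ⋃ i, p.2 i = univ ∧ ∀ σ ∈ p.1, ⋂ i ∈ σ, p.2 i = ∅}
  let r : P → P → Prop := fun p q => p.1.1 ⊆ q.1.1 ∧ (∀ i, q.1.2 i ⊆ p.1.2 i) ∧
    ∀ i, ∀ x ∈ p.1.2 i, x ∉ q.1.2 i → ∃ σ ∈ q.1.1, σ ∉ p.1.1 ∧ x ∈ closure (⋂ j ∈ σ, U j)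
  have hrefl : ∀ p, r p p := fun p =>
    ⟨Subset.rfl, fun _ => Subset.rfl, fun _ _ h h' => absurd h h'⟩
  have : Nonempty P := ⟨⟨(∅, U), hUo, fun _ => Subset.rfl, hUc, fun _ h => h.elim⟩⟩
  obtain ⟨⟨⟨S, W⟩, hWo, hWU, hWc, hWS⟩, hmax⟩ : ∃ m : P, ∀ a, r m a → r a m := by
    refine exists_maximal_of_nonempty_chains_bounded (fun c hc hcne => ?_) ?_
    · have htot : ∀ p ∈ c, ∀ q ∈ c, r p q ∨ r q p := fun p hp q hq => by
        rcases eq_or_ne p q with rfl | hpq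
        · exact Or.inl (hrefl p)
        · exact hc hp hq hpq
      have hfin : ∀ T : Finset (Finset ι),
          ∃ p ∈ c, ∀ τ ∈ T, ∀ q ∈ c, τ ∈ q.1.1 → τ ∈ p.1.1 := fun T => by
        induction T using Finset.induction_on with
        | empty => exact ⟨hcne.some, hcne.some_mem, by simp⟩
        | insert τ T _ ih =>
          obtain ⟨p, hp, hpT⟩ := ih
          by_cases hτ : ∃ q ∈ c, τ ∈ q.1.1
          · obtain ⟨q, hq, hqτ⟩ := hτ
            rcases htot p hp q hq with h | h
            · refine ⟨q, hq, fun τ' hτ' q' hq' hqτ' => ?_⟩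
              rcases Finset.mem_insert.1 hτ' with rfl | hτ'
              · exact hqτ
              · exact h.1 (hpT τ' hτ' q' hq' hqτ')
            · refine ⟨p, hp, fun τ' hτ' q' hq' hqτ' => ?_⟩
              rcases Finset.mem_insert.1 hτ' with rfl | hτ'
              · exact h.1 hqτ
              · exact hpT τ' hτ' q' hq' hqτ'
          · refine ⟨p, hp, fun τ' hτ' q' hq' hqτ' => ?_⟩
            rcases Finset.mem_insert.1 hτ' with rfl | hτ'
            · exact (hτ ⟨q', hq', hqτ'⟩).elim
            · exact hpT τ' hτ' q' hq' hqτ'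
      have hloc : ∀ x, ∃ O : Set X, IsOpen O ∧ x ∈ O ∧
          ∃ p ∈ c, ∀ i, p.1.2 i ∩ O ⊆ ⋂ q ∈ c, q.1.2 i := fun x => by
        obtain ⟨O', hO', hO'f⟩ := hUf x
        obtain ⟨O, hOO', hO, hxO⟩ := mem_nhds_iff.1 hO'
        have hIf : {i | (U i ∩ O).Nonempty}.Finite :=
          hO'f.subset fun i hi => hi.mono (inter_subset_inter_right _ hOO')
        obtain ⟨p, hp, hpT⟩ := hfin hIf.toFinset.powerset
        refine ⟨O, hO, hxO, p, hp, fun i y hy => mem_iInter₂.2 fun q hq => ?_⟩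
        by_contra hyq
        rcases htot p hp q hq with h | h
        · obtain ⟨σ, hσq, hσp, hσ⟩ := h.2.2 i y hy.1 hyq
          obtain ⟨z, hzO, hz⟩ := mem_closure_iff.1 hσ O hO hy.2
          refine hσp (hpT σ (Finset.mem_powerset.2 fun j hj => ?_) q hq hσq)
          exact hIf.mem_toFinset.2 ⟨z, mem_iInter₂.1 hz j hj, hzO⟩
        · exact hyq (h.2.1 i hy.1)
      refine ⟨⟨(⋃ p ∈ c, p.1.1, fun i => ⋂ p ∈ c, p.1.2 i), fun i => ?_, fun i => ?_, ?_, ?_⟩,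
        fun p hp => ⟨?_, fun i => ?_, fun i x hx hx' => ?_⟩⟩
      · refine isOpen_iff_forall_mem_open.2 fun x hx => ?_
        obtain ⟨O, hO, hxO, p, hp, h⟩ := hloc x
        exact ⟨p.1.2 i ∩ O, h i, (p.2.1 i).inter hO, mem_iInter₂.1 hx p hp, hxO⟩
      · obtain ⟨p, hp⟩ := hcne
        exact (biInter_subset_of_mem hp).trans (p.2.2.1 i)
      · refine eq_univ_of_forall fun x => mem_iUnion.2 ?_
        obtain ⟨O, -, hxO, p, hp, h⟩ := hloc x
        obtain ⟨i, hi⟩ := mem_iUnion.1 (p.2.2.2.1 ▸ mem_univ x)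
        exact ⟨i, h i ⟨hi, hxO⟩⟩
      · intro σ hσ
        obtain ⟨p, hp, hpσ⟩ := mem_iUnion₂.1 hσ
        refine subset_eq_empty ?_ (p.2.2.2.2 σ hpσ)
        exact iInter₂_mono fun i _ => biInter_subset_of_mem hp
      · exact fun σ hσ => mem_iUnion₂.2 ⟨p, hp, hσ⟩
      · exact biInter_subset_of_mem hp
      · obtain ⟨q, hq, hxq⟩ : ∃ q ∈ c, x ∉ q.1.2 i := by
          by_contra! h
          exact hx' (mem_iInter₂.2 h)
        rcases htot p hp q hq with h | h
        · obtain ⟨σ, hσq, hσ⟩ := h.2.2 i x hx hxq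
          exact ⟨σ, mem_iUnion₂.2 ⟨q, hq, hσq⟩, hσ⟩
        · exact (hxq (h.2.1 i hx)).elim
    · intro a b c hab hbc
      refine ⟨hab.1.trans hbc.1, fun i => (hbc.2.1 i).trans (hab.2.1 i), fun i x hxa hxc => ?_⟩
      by_cases hxb : x ∈ b.1.2 i
      · obtain ⟨σ, hσc, hσb, hσ⟩ := hbc.2.2 i x hxb hxc
        exact ⟨σ, hσc, fun h => hσb (hab.1 h), hσ⟩
      · obtain ⟨σ, hσb, hσ⟩ := hab.2.2 i x hxa hxb
        exact ⟨σ, hbc.1 hσb, hσ⟩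
  refine ⟨W, hWo, hWU, hWc, fun σ hσ => ?_⟩
  by_contra hne
  obtain ⟨W', hW'o, hW'W, hW'c, hW'σ, hW'⟩ := hdim.exists_shrink_finset hWo hWc hσ
  have hσS : σ ∉ S := fun h => hne (hWS σ h)
  refine hσS ((hmax ⟨(insert σ S, W'), hW'o, fun i => (hW'W i).trans (hWU i), hW'c, ?_⟩
    ⟨subset_insert _ _, hW'W, fun i x hx hx' => ⟨σ, mem_insert _ _, hσS, ?_⟩⟩).1
    (mem_insert _ _))
  · rintro τ (rfl | hτ)
    · exact hW'σ
    · refine subset_eq_empty ?_ (hWS τ hτ)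
      exact iInter₂_mono fun i _ => hW'W i
  · exact closure_mono (iInter₂_mono fun j _ => hWU j) (hW' i ⟨hx, hx'⟩)

/-! ### Simplices and the filling of their boundaries -/

/-- The simplex with vertex set `σ`, as a subset of the space of functions `ι → ℝ` with the product
topology: a point is the family of its barycentric coordinates, extended by zero. -/
def simplexOn {ι : Type*} (σ : Finset ι) : Set (ι → ℝ) :=
  {t | (∀ i, 0 ≤ t i) ∧ (∀ i, i ∉ σ → t i = 0) ∧ ∑ i ∈ σ, t i = 1}

open Classical in
/-- The set of indices of the nonzero coordinates of `t`, or the junk value `∅` if there are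
infinitely many of them. For a point of a simplex these are the vertices of the smallest face
containing it. -/
noncomputable def carrierFace {ι : Type*} (t : ι → ℝ) : Finset ι :=
  if h : (Function.support t).Finite then h.toFinset else ∅

section Simplex

variable {ι : Type*} {σ τ : Finset ι} {t : ι → ℝ}

theorem isClosed_simplexOn (σ : Finset ι) : IsClosed (simplexOn σ) := by
  simp only [simplexOn, ofPred_and, ofPred_forall]
  refine (isClosed_iInter fun i => isClosed_le continuous_const (continuous_apply i)).inter
    ((isClosed_iInter fun i => isClosed_iInter fun _ =>
      isClosed_eq (continuous_apply i) continuous_const).inter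
    (isClosed_eq (by fun_prop) continuous_const))

theorem simplexOn_mono (h : σ ⊆ τ) : simplexOn σ ⊆ simplexOn τ := fun t ht =>
  ⟨ht.1, fun i hi => ht.2.1 i fun hi' => hi (h hi'), by
    rw [← Finset.sum_subset h fun i _ hi => ht.2.1 i hi]; exact ht.2.2⟩

theorem simplexOn_empty : simplexOn (∅ : Finset ι) = ∅ :=
  eq_empty_of_forall_notMem fun t ht => by simpa using ht.2.2

theorem isCompact_simplexOn (σ : Finset ι) : IsCompact (simplexOn σ) := by
  refine (isCompact_univ_pi fun _ : ι => isCompact_Icc (a := (0 : ℝ)) (b := 1)).of_isClosed_subset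
    (isClosed_simplexOn σ) fun t ht i _ => ⟨ht.1 i, ?_⟩
  by_cases hi : i ∈ σ
  · exact (Finset.single_le_sum (fun j _ => ht.1 j) hi).trans ht.2.2.le
  · rw [ht.2.1 i hi]; exact zero_le_one

theorem mem_carrierFace (ht : t ∈ simplexOn σ) {i : ι} : i ∈ carrierFace t ↔ t i ≠ 0 := by
  have h : (Function.support t).Finite :=
    σ.finite_toSet.subset fun i hi => by_contra fun hiσ => hi (ht.2.1 i hiσ)
  rw [carrierFace, dif_pos h, h.mem_toFinset, Function.mem_support]

theorem carrierFace_subset (ht : t ∈ simplexOn σ) : carrierFace t ⊆ σ := fun i hi =>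
  by_contra fun hiσ => (mem_carrierFace ht).1 hi (ht.2.1 i hiσ)

theorem mem_simplexOn_carrierFace (ht : t ∈ simplexOn σ) : t ∈ simplexOn (carrierFace t) := by
  have h : ∀ i, i ∉ carrierFace t → t i = 0 := fun i hi =>
    by_contra fun hti => hi ((mem_carrierFace ht).2 hti)
  exact ⟨ht.1, h, by
    rw [Finset.sum_subset (carrierFace_subset ht) fun i _ hi => h i hi]; exact ht.2.2⟩

theorem carrierFace_nonempty (ht : t ∈ simplexOn σ) : (carrierFace t).Nonempty := by
  rw [Finset.nonempty_iff_ne_empty]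
  intro h
  simpa [h, simplexOn_empty] using mem_simplexOn_carrierFace ht

open Classical in
/-- If continuous maps of the `k`-sphere to `S` extend over the ball with values in `B`, then so do
continuous maps of the boundary of a `(k + 1)`-simplex. -/
theorem SphereFillable.exists_extension_simplexOn {Y : Type*} [TopologicalSpace Y] {k : ℕ}
    {S B : Set Y} (hSB : SphereFillable k S B) (hτ : τ.card = k + 2) {u : (ι → ℝ) → Y}
    (hu : ∀ i ∈ τ, ContinuousOn u (simplexOn (τ.erase i)))
    (huS : ∀ i ∈ τ, MapsTo u (simplexOn (τ.erase i)) S) :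
    ∃ v : (ι → ℝ) → Y, ContinuousOn v (simplexOn τ) ∧ MapsTo v (simplexOn τ) B ∧
      ∀ i ∈ τ, EqOn v u (simplexOn (τ.erase i)) := by
  obtain ⟨b⟩ : Nonempty (AffineBasis τ ℝ (EuclideanSpace ℝ (Fin (k + 1)))) :=
    AffineBasis.exists_affineBasis_of_finiteDimensional (by simp [hτ])
  set s := convexHull ℝ (range b) with hs
  have hsc : IsCompact s := (finite_range b).isCompact_convexHull (𝕜 := ℝ)
  have hsi : interior s = {x | ∀ i, 0 < b.coord i x} := b.interior_convexHull
  have hsn : s = {x | ∀ i, 0 ≤ b.coord i x} := b.convexHull_eq_nonneg_coord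
  have : Nonempty τ := Finset.Nonempty.to_subtype (Finset.card_pos.1 (by omega))
  obtain ⟨h, -, hcl, hfr⟩ := exists_homeomorph_image_interior_closure_frontier_eq_unitBall
    (convex_convexHull ℝ (range b)) ⟨_, b.centroid_mem_interior_convexHull⟩ hsc.isBounded
  rw [← hs, hsc.isClosed.closure_eq] at hcl
  rw [← hs] at hfr
  -- `L` takes barycentric coordinates with respect to `b`, and `M` is its inverse on the simplex.
  let L : EuclideanSpace ℝ (Fin (k + 1)) → ι → ℝ := fun e i =>
    if hi : i ∈ τ then b.coord ⟨i, hi⟩ e else 0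
  have hLτ : ∀ e (i : τ), L e i = b.coord i e := fun e i => dif_pos i.2
  have hLc : Continuous L := continuous_pi fun i => by
    by_cases hi : i ∈ τ
    · simp only [L, dif_pos hi]
      exact continuous_barycentric_coord b ⟨i, hi⟩
    · simp only [L, dif_neg hi]
      exact continuous_const
  have hL : ∀ e ∈ s, L e ∈ simplexOn τ := fun e he => by
    refine ⟨fun i => ?_, fun i hi => dif_neg hi, ?_⟩
    · by_cases hi : i ∈ τ
      · rw [hLτ e ⟨i, hi⟩]
        rw [hsn] at he
        exact he ⟨i, hi⟩
      · exact (show L e i = 0 from dif_neg hi).ge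
    · rw [← Finset.sum_coe_sort, ← b.sum_coord_apply_eq_one e]
      exact Finset.sum_congr rfl fun i _ => hLτ e i
  have hface : ∀ t ∈ simplexOn τ, ∀ i, t i = 0 → t ∈ simplexOn (τ.erase i) := fun t ht i hi => by
    refine ⟨ht.1, fun j hj => ?_, ?_⟩
    · by_cases hji : j = i
      · exact hji ▸ hi
      · exact ht.2.1 j fun hjτ => hj (Finset.mem_erase.2 ⟨hji, hjτ⟩)
    · rw [Finset.sum_erase _ hi]; exact ht.2.2
  have hLf : ∀ e ∈ frontier s, ∃ i ∈ τ, L e ∈ simplexOn (τ.erase i) := fun e he => by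
    rw [hsc.isClosed.frontier_eq, hsi] at he
    obtain ⟨i, hi⟩ := not_forall.1 he.2
    refine ⟨i, i.2, hface _ (hL e he.1) i ?_⟩
    exact le_antisymm ((hLτ e i).trans_le (not_lt.1 hi)) ((hL e he.1).1 i)
  let M : (ι → ℝ) → EuclideanSpace ℝ (Fin (k + 1)) := fun t => ∑ i : τ, t i • b i
  have hMc : Continuous M := by fun_prop
  have hM : ∀ t ∈ simplexOn τ, ∀ i : τ, b.coord i (M t) = t i := fun t ht i => by
    have hsum : ∑ i : τ, t i = 1 := by rw [Finset.sum_coe_sort]; exact ht.2.2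
    have := b.coord_apply_combination_of_mem (Finset.mem_univ i) (w := fun i : τ => t i) hsum
    rwa [Finset.affineCombination_eq_linear_combination _ _ _ hsum] at this
  have hMs : ∀ t ∈ simplexOn τ, M t ∈ s := fun t ht => by
    rw [hsn]
    exact fun i => (hM t ht i).symm ▸ ht.1 i
  have hMf : ∀ i ∈ τ, ∀ t ∈ simplexOn (τ.erase i), M t ∈ frontier s := fun i hi t ht => by
    have ht' := simplexOn_mono (τ.erase_subset i) ht
    rw [hsc.isClosed.frontier_eq, hsi]
    refine ⟨hMs t ht', fun hpos => (hpos ⟨i, hi⟩).ne' ?_⟩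
    rw [hM t ht']
    exact ht.2.1 i (Finset.notMem_erase i τ)
  have hLM : ∀ t ∈ simplexOn τ, L (M t) = t := fun t ht => by
    ext i
    by_cases hi : i ∈ τ
    · exact (hLτ _ ⟨i, hi⟩).trans (hM t ht ⟨i, hi⟩)
    · exact (dif_neg hi).trans (ht.2.1 i hi).symm
  have hub : ContinuousOn u (⋃ i : τ, simplexOn (τ.erase (i : ι))) :=
    (locallyFinite_of_finite _).continuousOn_iUnion (fun i => isClosed_simplexOn _)
      fun i => hu i i.2
  have hsph : ∀ y : Metric.sphere (0 : EuclideanSpace ℝ (Fin (k + 1))) 1,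
      h.symm y ∈ frontier s := fun y => by
    obtain ⟨e, he, hey⟩ := hfr.superset y.2
    rwa [← hey, h.symm_apply_apply]
  let g : C(Metric.sphere (0 : EuclideanSpace ℝ (Fin (k + 1))) 1, S) :=
    { toFun := fun y => ⟨u (L (h.symm y)), by
        obtain ⟨i, hi, hLi⟩ := hLf _ (hsph y)
        exact huS i hi hLi⟩
      continuous_toFun := by
        refine Continuous.subtype_mk (hub.comp_continuous (by fun_prop) fun y => ?_) _
        obtain ⟨i, hi, hLi⟩ := hLf _ (hsph y)
        exact mem_iUnion.2 ⟨⟨i, hi⟩, hLi⟩ }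
  obtain ⟨H, hH⟩ := hSB g
  have hball : ∀ t ∈ simplexOn τ,
      h (M t) ∈ Metric.closedBall (0 : EuclideanSpace ℝ (Fin (k + 1))) 1 := fun t ht =>
    hcl ▸ mem_image_of_mem h (hMs t ht)
  refine ⟨fun t => if ht : t ∈ simplexOn τ then H ⟨h (M t), hball t ht⟩ else u t, ?_, ?_, ?_⟩
  · rw [continuousOn_iff_continuous_domRestrict]
    have : Continuous fun t : simplexOn τ => (H ⟨h (M t), hball t t.2⟩ : Y) := by fun_prop
    refine this.congr fun t => ?_
    simp only [domRestrict_apply, dif_pos t.2]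
  · intro t ht
    simp only [dif_pos ht]
    exact Subtype.coe_prop _
  · intro i hi t ht
    have ht' := simplexOn_mono (τ.erase_subset i) ht
    have hy : h (M t) ∈ Metric.sphere (0 : EuclideanSpace ℝ (Fin (k + 1))) 1 :=
      hfr ▸ mem_image_of_mem h (hMf i hi t ht)
    simp only [dif_pos ht']
    refine (hH ⟨h (M t), hy⟩).trans ?_
    change u (L (h.symm (h (M t)))) = u t
    rw [h.symm_apply_apply, hLM t ht']

/-- Filling constant maps shows that a fillable set lies in the set where it is filled. -/
theorem SphereFillable.subset {Y : Type*} [TopologicalSpace Y] {k : ℕ} {S B : Set Y}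
    (hSB : SphereFillable k S B) : S ⊆ B := fun y hy => by
  obtain ⟨h, hh⟩ := hSB (ContinuousMap.const _ ⟨y, hy⟩)
  obtain ⟨x, hx⟩ : (Metric.sphere (0 : EuclideanSpace ℝ (Fin (k + 1))) 1).Nonempty :=
    NormedSpace.sphere_nonempty.2 zero_le_one
  have := hh ⟨x, hx⟩
  simp only [ContinuousMap.const_apply] at this
  exact this ▸ Subtype.coe_prop _

end Simplex

/-! ### Simplicial maps -/

section Push

variable {ι κ : Type*} {σ : Finset κ} {t : κ → ℝ}

open Classical in
/-- The simplicial map induced by a map `p` of vertices: the barycentric coordinate of the image at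
`i` is the sum of the coordinates over the fibre of `p` over `i`. -/
noncomputable def simplexMap (p : κ → ι) (t : κ → ℝ) : ι → ℝ :=
  fun i => ∑ j ∈ carrierFace t with p j = i, t j

open Classical in
theorem simplexMap_eq (p : κ → ι) (ht : t ∈ simplexOn σ) :
    simplexMap p t = fun i => ∑ j ∈ σ with p j = i, t j := by
  ext i
  refine Finset.sum_subset (Finset.filter_subset_filter _ (carrierFace_subset ht)) ?_
  intro j hj hj'
  by_contra h
  exact hj' (Finset.mem_filter.2 ⟨(mem_carrierFace ht).2 h, (Finset.mem_filter.1 hj).2⟩)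

open Classical in
theorem simplexMap_mem (p : κ → ι) (ht : t ∈ simplexOn σ) :
    simplexMap p t ∈ simplexOn (σ.image p) := by
  rw [simplexMap_eq p ht]
  refine ⟨fun i => Finset.sum_nonneg fun j _ => ht.1 j, fun i hi => ?_, ?_⟩
  · refine Finset.sum_eq_zero fun j hj => ?_
    obtain ⟨hjσ, rfl⟩ := Finset.mem_filter.1 hj
    exact (hi (Finset.mem_image_of_mem p hjσ)).elim
  · rw [← ht.2.2]
    exact Finset.sum_fiberwise_of_maps_to (fun j hj => Finset.mem_image_of_mem p hj) t

theorem continuousOn_simplexMap (p : κ → ι) (σ : Finset κ) :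
    ContinuousOn (simplexMap p) (simplexOn σ) := by
  classical
  have : Continuous fun t : κ → ℝ => fun i => ∑ j ∈ σ with p j = i, t j := by fun_prop
  exact this.continuousOn.congr fun t ht => simplexMap_eq p ht

end Push

/-! ### Maps of skeletons of nerves -/

/-- The function `u`, restricted to the `k`-skeleton of the nerve of the family `U`, is continuous
on each simplex and maps the simplex spanned by `σ` into `ψ x` for each `x` in the intersection of
the members of `U` indexed by `σ`. The values of `u` off the `k`-skeleton are irrelevant. -/
def IsNerveMap {X Y ι : Type*} [TopologicalSpace Y] (k : ℕ) (ψ : X → Set Y) (U : ι → Set X)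
    (u : (ι → ℝ) → Y) : Prop :=
  ∀ σ : Finset ι, σ.card ≤ k + 1 → ∀ x, (∀ i ∈ σ, x ∈ U i) →
    ContinuousOn u (simplexOn σ) ∧ MapsTo u (simplexOn σ) (ψ x)

section NerveMap

variable {X Y ι : Type*} [TopologicalSpace Y] {k : ℕ} {ψ ψ' : X → Set Y}

theorem IsNerveMap.mono {U W : ι → Set X} {u : (ι → ℝ) → Y} (hu : IsNerveMap k ψ U u)
    (hWU : ∀ i, W i ⊆ U i) : IsNerveMap k ψ W u := fun σ hσ x hx =>
  hu σ hσ x fun i hi => hWU i (hx i hi)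

theorem LowerLocallyConstant.exists_isNerveMap_zero [TopologicalSpace X] [Nonempty Y]
    (hψ : LowerLocallyConstant ψ) (hne : ∀ x, (ψ x).Nonempty) :
    ∃ (U : X → Set X) (u : (X → ℝ) → Y), (∀ x, IsOpen (U x)) ∧ ⋃ x, U x = univ ∧
      IsNerveMap 0 ψ U u := by
  classical
  choose y hy using hne
  refine ⟨fun x => {x' | {y x} ⊆ ψ x'}, fun t => if h : (carrierFace t).Nonempty then
    y h.choose else Classical.arbitrary Y, fun x => hψ _ isCompact_singleton,
    eq_univ_of_forall fun x => mem_iUnion.2 ⟨x, singleton_subset_iff.2 (hy x)⟩, ?_⟩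
  intro σ hσ x hx
  rcases σ.eq_empty_or_nonempty with rfl | hσ'
  · simp [simplexOn_empty, mapsTo_empty]
  obtain ⟨a, rfl⟩ := Finset.card_eq_one.1 (le_antisymm hσ hσ'.card_pos)
  have hval : ∀ t ∈ simplexOn {a}, (if h : (carrierFace t).Nonempty then
      y h.choose else Classical.arbitrary Y) = y a := fun t ht => by
    have h := carrierFace_nonempty ht
    rw [dif_pos h, Finset.mem_singleton.1 (carrierFace_subset ht h.choose_spec)]
  refine ⟨continuousOn_const.congr hval, fun t ht => ?_⟩
  dsimp only
  rw [hval t ht]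
  exact hx a (Finset.mem_singleton_self a) rfl

/-- A map of the `k`-skeleton of the full simplex on `F` extends over the `(k + 1)`-skeleton. -/
theorem SphereFillable.exists_extension_skeleton {S B : Set Y} (hSB : SphereFillable k S B)
    {F : Set ι} {u : (ι → ℝ) → Y}
    (hu : ∀ τ : Finset ι, ↑τ ⊆ F → τ.card ≤ k + 1 →
      ContinuousOn u (simplexOn τ) ∧ MapsTo u (simplexOn τ) S) :
    ∃ v : (ι → ℝ) → Y, (∀ τ : Finset ι, ↑τ ⊆ F → τ.card ≤ k + 2 →
      ContinuousOn v (simplexOn τ) ∧ MapsTo v (simplexOn τ) B) ∧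
      ∀ t, (carrierFace t).card ≤ k + 1 → v t = u t := by
  classical
  have hfill : ∀ τ : Finset ι, ∃ v : (ι → ℝ) → Y, ↑τ ⊆ F → τ.card = k + 2 →
      ContinuousOn v (simplexOn τ) ∧ MapsTo v (simplexOn τ) B ∧
        ∀ i ∈ τ, EqOn v u (simplexOn (τ.erase i)) := fun τ => by
    by_cases h : ↑τ ⊆ F ∧ τ.card = k + 2
    · have h' : ∀ i ∈ τ, ↑(τ.erase i) ⊆ F ∧ (τ.erase i).card ≤ k + 1 := fun i hi =>
        ⟨(Finset.coe_subset.2 (τ.erase_subset i)).trans h.1, by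
          rw [Finset.card_erase_of_mem hi]; omega⟩
      obtain ⟨v, hv⟩ := hSB.exists_extension_simplexOn h.2
        (fun i hi => (hu _ (h' i hi).1 (h' i hi).2).1)
        (fun i hi => (hu _ (h' i hi).1 (h' i hi).2).2)
      exact ⟨v, fun _ _ => hv⟩
    · exact ⟨u, fun h₁ h₂ => (h ⟨h₁, h₂⟩).elim⟩
  choose v hv using hfill
  refine ⟨fun t => if (carrierFace t).card ≤ k + 1 then u t else v (carrierFace t) t,
    fun τ hτF hτ => ?_, fun t ht => if_pos ht⟩
  rcases Nat.lt_or_ge (k + 1) τ.card with hlt | hle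
  · have hτ' : τ.card = k + 2 := by omega
    obtain ⟨hvc, hvB, hvu⟩ := hv τ hτF hτ'
    have heq : EqOn (fun t => if (carrierFace t).card ≤ k + 1 then u t else v (carrierFace t) t)
        (v τ) (simplexOn τ) := fun t ht => by
      dsimp only
      split_ifs with hc
      · obtain ⟨i, hi, hit⟩ := Finset.exists_mem_notMem_of_card_lt_card (hc.trans_lt hlt)
        exact (hvu i hi (simplexOn_mono (Finset.subset_erase.2 ⟨carrierFace_subset ht, hit⟩)
          (mem_simplexOn_carrierFace ht))).symm
      · rw [Finset.eq_of_subset_of_card_le (carrierFace_subset ht) (by omega)]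
    exact ⟨hvc.congr heq, hvB.congr heq.symm⟩
  · obtain ⟨huc, huS⟩ := hu τ hτF hle
    have heq : EqOn (fun t => if (carrierFace t).card ≤ k + 1 then u t else v (carrierFace t) t)
        u (simplexOn τ) := fun t ht =>
      if_pos ((Finset.card_le_card (carrierFace_subset ht)).trans hle)
    exact ⟨huc.congr heq, (huS.mono_right hSB.subset).congr heq.symm⟩

/-- The inductive step over skeletons. For each `x`, the given map extends over the
`(k + 1)`-skeleton of the simplex spanned by all members of `U` containing `x`, the extension `v x`
having its values in `ψ' x`. The image of that skeleton is compact, so it lies in `ψ' x'` for all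
`x'` near `x`. A new cover is indexed by pairs `(x, i)`, in such a way that if the members with
indices `(x, i)` and `(x', i')` meet, then `x ∈ U i'`; hence on a simplex with a vertex `(x, i)` the
extension `v x` can be used, after the simplicial map induced by `(x', i') ↦ i'`. -/
theorem IsNerveMap.exists_succ [TopologicalSpace X] [NormalSpace X] {U : ι → Set X}
    {u : (ι → ℝ) → Y} (hu : IsNerveMap k ψ U u) (hUo : ∀ i, IsOpen (U i)) (hUc : ⋃ i, U i = univ)
    (hUf : LocallyFinite U) (hψ' : LowerLocallyConstant ψ')
    (hfill : ∀ x, SphereFillable k (ψ x) (ψ' x)) [Nonempty X] :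
    ∃ (W : X × ι → Set X) (w : (X × ι → ℝ) → Y), (∀ j, IsOpen (W j)) ∧ ⋃ j, W j = univ ∧
      IsNerveMap (k + 1) ψ' W w := by
  classical
  obtain ⟨G, hGc, hGo, hGU⟩ := exists_iUnion_eq_closure_subset hUo hUf.point_finite hUc
  have hext : ∀ x, _ := fun x => (hfill x).exists_extension_skeleton (F := {i | x ∈ U i}) (u := u)
    fun τ hτ hτk => hu τ hτk x fun i hi => hτ hi
  choose v hv hvu using hext
  let K : X → Set Y := fun x =>
    ⋃ τ ∈ {τ : Finset ι | ↑τ ⊆ {i | x ∈ U i} ∧ τ.card ≤ k + 2}, v x '' simplexOn τ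
  have hK : ∀ x, IsCompact (K x) := fun x => by
    refine Set.Finite.isCompact_biUnion ?_ fun τ hτ =>
      (isCompact_simplexOn τ).image_of_continuousOn (hv x τ hτ.1 hτ.2).1
    refine (hUf.point_finite x).toFinset.powerset.finite_toSet.subset fun τ hτ => ?_
    exact Finset.mem_powerset.2 fun i hi => (hUf.point_finite x).mem_toFinset.2 (hτ.1 hi)
  have hKψ : ∀ x, K x ⊆ ψ' x := fun x => iUnion₂_subset fun τ hτ =>
    (hv x τ hτ.1 hτ.2).2.image_subset
  -- Removing the closed sets `closure (G i)` with `x ∉ U i` ensures that `N x` meets `G i` only if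
  -- `x ∈ U i`.
  let N : X → Set X := fun x => {x' | K x ⊆ ψ' x'} ∩ (⋃ i : {i // x ∉ U i}, closure (G i))ᶜ
  have hNo : ∀ x, IsOpen (N x) := fun x => by
    refine (hψ' _ (hK x)).inter (LocallyFinite.isClosed_iUnion ?_ fun _ =>
      isClosed_closure).isOpen_compl
    exact (hUf.subset hGU).comp_injective Subtype.val_injective
  have hxN : ∀ x, x ∈ N x := fun x => by
    refine ⟨hKψ x, fun h => ?_⟩
    obtain ⟨i, hi⟩ := mem_iUnion.1 h
    exact i.2 (hGU i hi)
  have hNU : ∀ x z i, z ∈ N x → z ∈ G i → x ∈ U i := fun x z i hz hzi => by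
    by_contra hx
    exact hz.2 (mem_iUnion.2 ⟨⟨i, hx⟩, subset_closure hzi⟩)
  -- Any vertex of the smallest face containing a point serves to select the extension used there.
  let c : (X × ι → ℝ) → X := fun t =>
    if h : (carrierFace t).Nonempty then h.choose.1 else Classical.arbitrary X
  refine ⟨fun j => N j.1 ∩ G j.2, fun t => v (c t) (simplexMap Prod.snd t),
    fun j => (hNo _).inter (hGo _), eq_univ_of_forall fun x => ?_, ?_⟩
  · obtain ⟨i, hi⟩ := mem_iUnion.1 (hGc ▸ mem_univ x)
    exact mem_iUnion.2 ⟨(x, i), hxN x, hi⟩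
  intro σ hσ z hz
  rcases σ.eq_empty_or_nonempty with rfl | ⟨j₀, hj₀⟩
  · simp [simplexOn_empty, mapsTo_empty]
  -- `c` is constant on the open simplex spanned by `σ`.
  obtain ⟨a, haσ, ha⟩ : ∃ a : X, (∃ i, (a, i) ∈ σ) ∧
      ∀ t ∈ simplexOn σ, carrierFace t = σ → c t = a := by
    refine ⟨if h : σ.Nonempty then h.choose.1 else Classical.arbitrary X, ?_, fun t ht h => ?_⟩
    · rw [dif_pos ⟨j₀, hj₀⟩]
      exact ⟨_, (⟨j₀, hj₀⟩ : σ.Nonempty).choose_spec⟩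
    · simp only [c, h]
  obtain ⟨i, hai⟩ := haσ
  have hsub : ↑(σ.image Prod.snd) ⊆ {i | a ∈ U i} := fun i' hi' => by
    obtain ⟨j, hj, rfl⟩ := Finset.mem_image.1 hi'
    exact hNU a z j.2 (hz _ hai).1 (hz j hj).2
  have hcard : (σ.image Prod.snd).card ≤ k + 2 := Finset.card_image_le.trans hσ
  obtain ⟨hvc, -⟩ := hv a _ hsub hcard
  have heq : EqOn (fun t => v (c t) (simplexMap Prod.snd t))
      (fun t => v a (simplexMap Prod.snd t)) (simplexOn σ) := fun t ht => by
    dsimp only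
    by_cases h : carrierFace t = σ
    · rw [ha t ht h]
    · -- On a proper face, all the extensions agree with `u`.
      have hlt : (carrierFace t).card < σ.card :=
        Finset.card_lt_card ((carrierFace_subset ht).ssubset_of_ne h)
      have hmem := simplexMap_mem (Prod.snd : X × ι → ι) (mem_simplexOn_carrierFace ht)
      have hle : (carrierFace (simplexMap Prod.snd t)).card ≤ k + 1 :=
        (Finset.card_le_card (carrierFace_subset hmem)).trans
          (Finset.card_image_le.trans (by omega))
      rw [hvu _ _ hle, hvu _ _ hle]
  refine ⟨(hvc.comp (continuousOn_simplexMap _ σ) fun t ht => simplexMap_mem _ ht).congr heq,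
    fun t ht => ?_⟩
  rw [heq ht]
  exact (hz _ hai).1.1 (mem_iUnion₂.2 ⟨_, ⟨hsub, hcard⟩, mem_image_of_mem _ (simplexMap_mem _ ht)⟩)

/-- A map of the `n`-skeleton of the nerve of an open cover yields a selection if `X` is paracompact
of covering dimension at most `n`: shrink the cover to order `n` and compose with the map into the
nerve given by a partition of unity. -/
theorem IsNerveMap.exists_selection [TopologicalSpace X] [NormalSpace X] [ParacompactSpace X]
    {n : ℕ} (hdim : CoveringDimLE X n) {U : ι → Set X} {u : (ι → ℝ) → Y}
    (hu : IsNerveMap n ψ U u) (hUo : ∀ i, IsOpen (U i)) (hUc : ⋃ i, U i = univ)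
    (hUf : LocallyFinite U) : ∃ f : X → Y, Continuous f ∧ ∀ x, f x ∈ ψ x := by
  obtain ⟨W, hWo, hWU, hWc, hW⟩ := hdim.exists_shrink hUo hUc hUf
  obtain ⟨ρ, hρ⟩ := PartitionOfUnity.exists_isSubordinate isClosed_univ W hWo hWc.ge
  let R : X → ι → ℝ := fun x i => ρ i x
  have hRc : Continuous R := continuous_pi fun i => (ρ i).continuous
  have hRmem : ∀ x, R x ∈ simplexOn (ρ.finsupport x) := fun x =>
    ⟨fun i => ρ.nonneg i x, fun i hi => by_contra fun h => hi ((ρ.mem_finsupport x).2 h),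
      ρ.sum_finsupport (mem_univ x)⟩
  have hsW : ∀ x, ∀ i ∈ ρ.finsupport x, x ∈ W i := fun x i hi =>
    hρ i (subset_closure ((ρ.mem_finsupport x).1 hi))
  have hcard : ∀ x, (ρ.finsupport x).card ≤ n + 1 := fun x => by
    by_contra! h
    obtain ⟨σ, hσ, hσn⟩ := Finset.exists_subset_card_eq (show n + 2 ≤ _ from h)
    have hx : x ∈ ⋂ i ∈ σ, W i := mem_iInter₂.2 fun i hi => hsW x i (hσ hi)
    rwa [hW σ hσn] at hx
  have huf := fun x => hu _ (hcard x) x fun i hi => hWU i (hsW x i hi)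
  refine ⟨fun x => u (R x), ?_, fun x => (huf x).2 (hRmem x)⟩
  -- Continuity is checked on the locally finite closed cover by the closures of the sets on which
  -- the support of the partition of unity is a given finite set.
  let E : Finset ι → Set X := fun σ => {x | ρ.finsupport x = σ}
  have hE : LocallyFinite E := fun x => by
    refine ⟨_, ρ.eventually_finsupport_subset x, ?_⟩
    refine (ρ.fintsupport x).powerset.finite_toSet.subset ?_
    rintro σ ⟨y, rfl, hy⟩
    exact Finset.mem_powerset.2 hy
  refine hE.closure.continuous (eq_univ_of_forall fun x =>
    mem_iUnion.2 ⟨ρ.finsupport x, subset_closure rfl⟩) (fun _ => isClosed_closure) fun σ => ?_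
  have hmaps : MapsTo R (closure (E σ)) (simplexOn σ) :=
    closure_minimal (fun x hx => by
      have := hRmem x
      rwa [show ρ.finsupport x = σ from hx] at this) ((isClosed_simplexOn σ).preimage hRc)
  rcases (E σ).eq_empty_or_nonempty with h | ⟨x, rfl⟩
  · rw [h, closure_empty]
    exact continuousOn_empty _
  · exact (huf x).1.comp hRc.continuousOn hmaps

end NerveMap

universe u v in
/-- For each term `φ k` of an aspherical sequence, some locally finite open cover admits a map of
the `k`-skeleton of its nerve adapted to `φ k`. The index types that arise all lie
in the universe of `X` because the first cover is indexed by `X` itself. -/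
theorem IsAspherical.exists_isNerveMap {X : Type u} {Y : Type v} [TopologicalSpace X]
    [NormalSpace X] [ParacompactSpace X] [Nonempty X] [TopologicalSpace Y] [Nonempty Y] {n : ℕ}
    {φ : Fin (n + 1) → X → Set Y} (hasph : IsAspherical φ) (hne : ∀ x, (φ 0 x).Nonempty)
    (hllc : ∀ k, LowerLocallyConstant (φ k)) (k : Fin (n + 1)) :
    ∃ (ι : Type u) (U : ι → Set X) (w : (ι → ℝ) → Y), (∀ i, IsOpen (U i)) ∧ ⋃ i, U i = univ ∧
      LocallyFinite U ∧ IsNerveMap k (φ k) U w := by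
  induction k using Fin.induction with
  | zero =>
    obtain ⟨U, w, hUo, hUc, hw⟩ := (hllc 0).exists_isNerveMap_zero hne
    obtain ⟨W, hWo, hWc, hWf, hWU⟩ := precise_refinement U hUo hUc
    exact ⟨X, W, w, hWo, hWc, hWf, hw.mono hWU⟩
  | succ k ih =>
    obtain ⟨ι, U₀, w₀, hUo₀, hUc₀, hUf₀, hw₀⟩ := ih
    obtain ⟨U, w, hUo, hUc, hw⟩ := hw₀.exists_succ hUo₀ hUc₀ hUf₀ (hllc k.succ) (hasph k)
    obtain ⟨W, hWo, hWc, hWf, hWU⟩ := precise_refinement U hUo hUc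
    exact ⟨X × ι, W, w, hWo, hWc, hWf, hw.mono hWU⟩

theorem theorem3p1 {X Y : Type*} [TopologicalSpace X] [T2Space X] [ParacompactSpace X]
    [TopologicalSpace Y] [T2Space Y] (n : ℕ) (hdim : CoveringDimLE X n)
    (φ : Fin (n + 1) → X → Set Y)
    (hne : ∀ k x, (φ k x).Nonempty)
    (hllc : ∀ k, LowerLocallyConstant (φ k))
    (hasph : IsAspherical φ) :
    ∃ f : X → Y, Continuous f ∧ ∀ x, f x ∈ φ (Fin.last n) x := by
  rcases isEmpty_or_nonempty X with hX | ⟨⟨x₀⟩⟩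
  · exact ⟨isEmptyElim, continuous_of_discreteTopology, isEmptyElim⟩
  have : Nonempty X := ⟨x₀⟩
  have : Nonempty Y := (hne 0 x₀).to_type
  obtain ⟨ι, U, w, hUo, hUc, hUf, hw⟩ := hasph.exists_isNerveMap (hne 0) hllc (Fin.last n)
  exact hw.exists_selection hdim hUo hUc hUf
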